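/- A copula is a distribution function $C$ on $\mathbb R^2$ whose two marginals are uniform on $[0,1]$. A (strictly) stationary real-valued Markov chain $(U_i)_{i\in\mathbb Z}$ on a probability space $(\Omega,\mathcal K,\mathbb P)$ is said to be generated by the copula $C$ if $U_0$ is uniformly distributed on $[0,1]$, with distribution function $F$, and $\mathbb P(U_0\le x,\ U_1\le y)=C(F(x),F(y))$ for all $x,y\in\mathbb R$. For $\sigma$-algebras $\mathcal A,\mathcal B\subseteq\mathcal K$ put $$\beta(\mathcal A,\mathcal B)=\frac12\sup\sum_{i=1}^{p}\sum_{l=1}^{q}\bigl|\mathbb P(A_i\cap B_l)-\mathbb P(A_i)\mathbb P(B_l)\bigr|,$$ where the supremum is over all finite partitions $\{A_1,\dots,A_p\}$, $\{B_1,\dots,B_q\}$ of $\Omega$ with $A_i\in\mathcal A$ and $B_l\in\mathcal B$. The chain is absolutely regular if $\beta_m:=\beta\bigl(\sigma(U_k,\,k\le 0),\,\sigma(U_k,\,k\ge m)\bigr)\to0$ as $m\to\infty$. **Lemma 3.1.** Let $C_1,\dots,C_n$ be copulas such that, for some $1\le j\le n$, $C_j$ generates an absolutely regular Markov chain. Let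 $a_1,\dots,a_n\in[0,1]$ with $\sum_{k=1}^n a_k=1$ and $a_j\ne0$. Then every stationary Markov chain generated by the convex combination $\sum_{k=1}^n a_kC_k$ is absolutely regular. -/

import Mathlib

open MeasureTheory ProbabilityTheory Filter Topology

namespace CopulaChain

noncomputable section

/-- The uniform distribution on `[0,1]`, as a measure on the real line. -/
def uniformLaw : Measure ℝ := volume.restrict (Set.Icc 0 1)

/-- A `2`-copula: the distribution function of a probability measure on the plane both of whose
marginals are uniform on `[0,1]`. -/
def IsCopula (C : ℝ → ℝ → ℝ) : Prop :=
  ∃ μ : Measure (ℝ × ℝ), IsProbabilityMeasure μ ∧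
    μ.map Prod.fst = uniformLaw ∧ μ.map Prod.snd = uniformLaw ∧
    ∀ x y : ℝ, C x y = μ.real (Set.Iic x ×ˢ Set.Iic y)

variable {Ω : Type*}

/-- `σ(X k, k ≤ n)`, the information provided by the process up to time `n`. -/
abbrev past (X : ℤ → Ω → ℝ) (n : ℤ) : MeasurableSpace Ω :=
  ⨆ k : ℤ, ⨆ _ : k ≤ n, MeasurableSpace.comap (X k) inferInstance

/-- `σ(X k, k ≥ n)`, the information provided by the process from time `n` on. -/
abbrev future (X : ℤ → Ω → ℝ) (n : ℤ) : MeasurableSpace Ω :=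
  ⨆ k : ℤ, ⨆ _ : n ≤ k, MeasurableSpace.comap (X k) inferInstance

/-- A finite partition of `Ω` into sets of the `σ`-algebra `𝒜`. -/
structure IsMeasurablePartition (𝒜 : MeasurableSpace Ω) {n : ℕ} (A : Fin n → Set Ω) : Prop where
  measurable : ∀ i, MeasurableSet[𝒜] (A i)
  disjoint : Pairwise fun i i' => Disjoint (A i) (A i')
  cover : ⋃ i, A i = Set.univ

variable [MeasurableSpace Ω]

/-- The absolutely regular coefficient `β(𝒜, ℬ)` between two `σ`-algebras. For a probability
measure the sums are at most `2`, so the supremum is that of a nonempty bounded set. -/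
def betaCoeff (P : Measure Ω) (𝒜 ℬ : MeasurableSpace Ω) : ℝ :=
  1 / 2 * sSup {s : ℝ | ∃ (n m : ℕ) (A : Fin n → Set Ω) (B : Fin m → Set Ω),
    IsMeasurablePartition 𝒜 A ∧ IsMeasurablePartition ℬ B ∧
    s = ∑ i, ∑ j, |P.real (A i ∩ B j) - P.real (A i) * P.real (B j)|}

/-- `β_n`, the coefficient between `σ(X k, k ≤ 0)` and `σ(X k, k ≥ n)`. -/
def betaMixing (P : Measure Ω) (X : ℤ → Ω → ℝ) (n : ℕ) : ℝ :=
  betaCoeff P (past X 0) (future X n)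

/-- Absolute regularity: `β_n → 0`. -/
def IsAbsolutelyRegular (P : Measure Ω) (X : ℤ → Ω → ℝ) : Prop :=
  Tendsto (betaMixing P X) atTop (𝓝 0)

/-- A (strictly) stationary real Markov chain indexed by `ℤ`. -/
structure IsStationaryMarkovChain (P : Measure Ω) (X : ℤ → Ω → ℝ) : Prop where
  measurable : ∀ i, Measurable (X i)
  /-- The law of the whole path is invariant under the time shift. -/
  stationary : P.map (fun ω (i : ℤ) => X (i + 1) ω) = P.map (fun ω (i : ℤ) => X i ω)
  /-- `P(X (n+1) ∈ B | σ(X k, k ≤ n)) = P(X (n+1) ∈ B | X n)` almost surely. -/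
  markov : ∀ (n : ℤ) (B : Set ℝ), MeasurableSet B →
    P[(X (n + 1) ⁻¹' B).indicator (fun _ => (1 : ℝ)) | past X n] =ᵐ[P]
      P[(X (n + 1) ⁻¹' B).indicator (fun _ => (1 : ℝ)) |
        MeasurableSpace.comap (X n) inferInstance]

/-- `X` is a stationary Markov chain generated by the marginal distribution `π`, with distribution
function `F`, and the copula `C`: the joint distribution function of `(X 0, X 1)` is
`C (F x) (F y)`. -/
structure IsGeneratedBy (P : Measure Ω) (X : ℤ → Ω → ℝ) (π : Measure ℝ) (C : ℝ → ℝ → ℝ) :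
    Prop where
  chain : IsStationaryMarkovChain P X
  marginal : P.map (X 0) = π
  joint : ∀ x y : ℝ, P.real {ω | X 0 ω ≤ x ∧ X 1 ω ≤ y} = C (cdf π x) (cdf π y)

/-- `X` is a stationary Markov chain generated by the copula `C`; the marginal distribution, when
it is not specified, is uniform on `[0,1]`. -/
def IsGeneratedByCopula (P : Measure Ω) (X : ℤ → Ω → ℝ) (C : ℝ → ℝ → ℝ) : Prop :=
  IsGeneratedBy P X uniformLaw C

end

end CopulaChain

/-! For a stationary Markov chain with transition kernel `κ` and marginal `π`, `β_m` is, up to a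
constant factor, the total variation distance between the law `π ⊗ κ ^ m` of `(X 0, X m)` and `π ×
π`. This turns the theorem into a statement about kernels (`HasTransition.mixingBound`,
`HasTransition.betaMixing_le`).

Let `Q` be the kernel of `C j` and `R` that of the combination, so `R ≥ a Q` with `a = a j > 0`,
hence `R ^ m ≥ p Q ^ m` with `p = a ^ m`. Choose `m` with `Q ^ m` within `ε` of independence. A
block of `m` steps of `R` follows `Q ^ m` with weight `p`; the remaining mass has second marginal
`(1 - p) π`, so whatever `k` further blocks achieve from `π` they achieve on it too. Thus the
distance `δ_k` after `k` blocks satisfies `δ_{k+1} ≤ p ε + (1 - p) δ_k`, so `δ_k ≤ ε + (1 - p) ^ k`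
(`MixingBound.comp_of_smul_le`, `exists_mixingBound_pow`). Further steps never increase the
distance.

One-sided bounds suffice throughout: two measures of equal mass have equal positive and negative
deviations. -/

namespace CopulaChain

open scoped ENNReal

/-! ### Mixing of powers of a kernel under a minorization -/

section Kernels

variable {α : Type*} [MeasurableSpace α] {π : Measure α}

/-- The total variation distance between `π ⊗ κ` and `π × π` is at most `ε`, expressed through
integrals of functions with values in `[0,1]`. -/
def MixingBound (π : Measure α) (κ : Kernel α α) (ε : ℝ≥0∞) : Prop :=
  ∀ F : α × α → ℝ≥0∞, Measurable F → (∀ z, F z ≤ 1) →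
    ∫⁻ x, ∫⁻ y, F (x, y) ∂κ x ∂π ≤ ∫⁻ x, ∫⁻ y, F (x, y) ∂π ∂π + ε

theorem measurable_lintegral_kernel_snd {T : Kernel α α} [IsSFiniteKernel T]
    {F : α × α → ℝ≥0∞} (hF : Measurable F) :
    Measurable fun p : α × α => ∫⁻ z, F (p.1, z) ∂T p.2 := by
  have h : Measurable fun p : α × α => ∫⁻ z, F (p.1, z) ∂(Kernel.prodMkLeft α T) p :=
    Measurable.lintegral_kernel_prod_right (κ := Kernel.prodMkLeft α T)
      (f := fun p z => F (p.1, z)) (by unfold Function.uncurry; fun_prop)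
  simpa [Kernel.prodMkLeft_apply] using h

theorem lintegral_kernel_of_invariant {T : Kernel α α} (hT : T.Invariant π)
    {f : α → ℝ≥0∞} (hf : Measurable f) : ∫⁻ y, ∫⁻ z, f z ∂T y ∂π = ∫⁻ z, f z ∂π := by
  conv_rhs => rw [← hT.def]
  rw [Measure.lintegral_bind T.aemeasurable hf.aemeasurable]

/-- Integrating out the last step `T` gives another test function with values in `[0,1]`, and
invariance leaves its integral under `π × π` unchanged. -/
theorem MixingBound.comp_left {A T : Kernel α α} [IsMarkovKernel T] {ε : ℝ≥0∞}
    (h : MixingBound π A ε) (hT : T.Invariant π) : MixingBound π (T ∘ₖ A) ε := by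
  intro F hF hF1
  have := h (fun p => ∫⁻ z, F (p.1, z) ∂T p.2) (measurable_lintegral_kernel_snd hF) (fun p => by
    calc ∫⁻ z, F (p.1, z) ∂T p.2 ≤ ∫⁻ _, 1 ∂T p.2 := lintegral_mono fun z => hF1 _
      _ = 1 := by simp)
  calc ∫⁻ x, ∫⁻ y, F (x, y) ∂(T ∘ₖ A) x ∂π
      = ∫⁻ x, ∫⁻ y, ∫⁻ z, F (x, z) ∂T y ∂A x ∂π := by
        refine lintegral_congr fun x => ?_
        rw [Kernel.lintegral_comp _ _ _ (by fun_prop)]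
    _ ≤ ∫⁻ x, ∫⁻ y, ∫⁻ z, F (x, z) ∂T y ∂π ∂π + ε := this
    _ = ∫⁻ x, ∫⁻ y, F (x, y) ∂π ∂π + ε := by
        congr 1
        refine lintegral_congr fun x => ?_
        exact lintegral_kernel_of_invariant hT (by fun_prop)

/-- Prepending a transition with measure `σ`, whose second marginal is `c • π`, to a kernel. -/
theorem MixingBound.lintegral_le [StandardBorelSpace α] [Nonempty α] [IsProbabilityMeasure π]
    {T : Kernel α α} [IsMarkovKernel T] {δ c : ℝ≥0∞} (h : MixingBound π T δ)
    (σ : Measure (α × α)) [IsFiniteMeasure σ] (hσ : σ.snd = c • π)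
    {F : α × α → ℝ≥0∞} (hF : Measurable F) (hF1 : ∀ z, F z ≤ 1) :
    ∫⁻ p, ∫⁻ z, F (p.1, z) ∂T p.2 ∂σ ≤ ∫⁻ p, ∫⁻ z, F (p.1, z) ∂π ∂σ + c * δ := by
  -- Disintegrate `σ` backwards, over its second coordinate: `κ y` is the law of the starting point
  -- given the arrival point `y`.
  set ρ : Measure (α × α) := σ.map Prod.swap with hρ
  have hfst : ρ.fst = c • π := by rw [hρ, Measure.fst_map_swap, hσ]
  set κ := ρ.condKernel
  have hρκ : (c • π) ⊗ₘ κ = ρ := by rw [← hfst]; exact ρ.disintegrate ρ.condKernel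
  have : IsFiniteMeasure (c • π) := hfst ▸ inferInstance
  have hσρ : σ = ρ.map Prod.swap := by
    rw [hρ, Measure.map_map measurable_swap measurable_swap]; simp
  -- Given `y`, the start and the next point are independent, so the start can be averaged out
  -- first. What remains is a test function of `(y, z)` integrated against `c • π ⊗ S`; both sides
  -- of the goal have this form, with `S = T` and `S` constantly `π`.
  have key : ∀ S : Kernel α α, IsMarkovKernel S → ∫⁻ p, ∫⁻ z, F (p.1, z) ∂S p.2 ∂σ
      = c * ∫⁻ y, ∫⁻ z, ∫⁻ x, F (x, z) ∂κ y ∂S y ∂π := by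
    intro S _
    have hm : Measurable fun q : α × α => ∫⁻ z, F (q.swap.1, z) ∂S q.swap.2 :=
      (measurable_lintegral_kernel_snd (T := S) hF).comp measurable_swap
    rw [hσρ, lintegral_map (measurable_lintegral_kernel_snd hF) measurable_swap, ← hρκ,
      Measure.lintegral_compProd hm, lintegral_smul_measure, smul_eq_mul]
    congr 1
    refine lintegral_congr fun y => ?_
    exact lintegral_lintegral_swap (μ := κ y) (ν := S y) (f := fun x z => F (x, z)) hF.aemeasurable
  have hconst := key (Kernel.const α π) inferInstance
  simp only [Kernel.const_apply] at hconst
  rw [key T inferInstance, hconst, ← mul_add]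
  gcongr
  refine h (fun q => ∫⁻ x, F (x, q.2) ∂κ q.1) ?_ fun q => ?_
  · have hm := measurable_lintegral_kernel_snd (T := κ) (hF.comp measurable_swap)
    exact hm.comp measurable_swap
  · calc ∫⁻ x, F (x, q.2) ∂κ q.1 ≤ ∫⁻ _, 1 ∂κ q.1 := lintegral_mono fun z => hF1 _
      _ = 1 := by simp

/-- The recursion step. Split `π ⊗ B` into `p • (π ⊗ A)` and a remainder `σ`. On the first piece `A`
has already mixed and `T` does no harm; on the second, `T` mixes because `σ` arrives with law
proportional to `π`. -/
theorem MixingBound.comp_of_smul_le [StandardBorelSpace α] [Nonempty α] [IsProbabilityMeasure π]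
    {T A B : Kernel α α} [IsMarkovKernel T] [IsMarkovKernel A] [IsMarkovKernel B]
    (hTi : T.Invariant π) (hAi : A.Invariant π) (hBi : B.Invariant π)
    {p ε δ : ℝ≥0∞} (hp : p ≠ ∞) (hAB : ∀ x, p • A x ≤ B x)
    (hA : MixingBound π A ε) (hT : MixingBound π T δ) :
    MixingBound π (T ∘ₖ B) (p * ε + (1 - p) * δ) := by
  intro F hF hF1
  have hle : p • (π ⊗ₘ A) ≤ π ⊗ₘ B := by
    refine Measure.le_iff.2 fun s hs => ?_
    rw [Measure.smul_apply, Measure.compProd_apply hs, Measure.compProd_apply hs, smul_eq_mul,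
      ← lintegral_const_mul' _ _ hp]
    exact lintegral_mono fun x => hAB x _
  have : IsFiniteMeasure (p • (π ⊗ₘ A)) := Measure.smul_finite _ hp
  set σ := π ⊗ₘ B - p • (π ⊗ₘ A)
  have hadd : σ + p • (π ⊗ₘ A) = π ⊗ₘ B := Measure.sub_add_cancel_of_le hle
  have hsndA : (π ⊗ₘ A).snd = π := by rw [Measure.snd_compProd]; exact hAi
  have hsndB : (π ⊗ₘ B).snd = π := by rw [Measure.snd_compProd]; exact hBi
  have hσ : σ.snd = (1 - p) • π := by
    ext s hs
    have h1 : σ.snd s + p * π s = π s := by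
      conv_rhs => rw [← hsndB]
      conv_lhs => rw [← hsndA]
      rw [Measure.snd_apply hs, Measure.snd_apply hs, Measure.snd_apply hs, ← hadd]
      simp
    rw [Measure.smul_apply, smul_eq_mul, ENNReal.sub_mul (fun _ _ => measure_ne_top _ _), one_mul]
    exact ENNReal.eq_sub_of_add_eq (ENNReal.mul_ne_top hp (measure_ne_top _ _)) h1
  have hmG := measurable_lintegral_kernel_snd (T := T) hF
  have hmK : Measurable fun q : α × α => ∫⁻ z, F (q.1, z) ∂π := by
    simpa using measurable_lintegral_kernel_snd (T := Kernel.const α π) hF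
  have h1 := hT.lintegral_le σ hσ hF hF1
  have h2 : ∫⁻ q, ∫⁻ z, F (q.1, z) ∂T q.2 ∂(π ⊗ₘ A) ≤ ∫⁻ x, ∫⁻ y, F (x, y) ∂π ∂π + ε := by
    rw [Measure.lintegral_compProd hmG]
    refine le_trans (le_of_eq ?_) (hA.comp_left hTi F hF hF1)
    refine lintegral_congr fun x => ?_
    rw [Kernel.lintegral_comp _ _ _ (by fun_prop)]
  have hK : ∀ S : Kernel α α, IsMarkovKernel S →
      ∫⁻ q, ∫⁻ z, F (q.1, z) ∂π ∂(π ⊗ₘ S) = ∫⁻ x, ∫⁻ y, F (x, y) ∂π ∂π := by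
    intro S _
    rw [Measure.lintegral_compProd hmK]
    simp
  calc ∫⁻ x, ∫⁻ y, F (x, y) ∂(T ∘ₖ B) x ∂π
      = ∫⁻ q, ∫⁻ z, F (q.1, z) ∂T q.2 ∂(π ⊗ₘ B) := by
        rw [Measure.lintegral_compProd hmG]
        refine lintegral_congr fun x => ?_
        rw [Kernel.lintegral_comp _ _ _ (by fun_prop)]
    _ = ∫⁻ q, ∫⁻ z, F (q.1, z) ∂T q.2 ∂σ + p * ∫⁻ q, ∫⁻ z, F (q.1, z) ∂T q.2 ∂(π ⊗ₘ A) := by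
        rw [← hadd, lintegral_add_measure, lintegral_smul_measure, smul_eq_mul]
    _ ≤ (∫⁻ q, ∫⁻ z, F (q.1, z) ∂π ∂σ + (1 - p) * δ)
          + p * (∫⁻ x, ∫⁻ y, F (x, y) ∂π ∂π + ε) := by gcongr
    _ = (∫⁻ q, ∫⁻ z, F (q.1, z) ∂π ∂σ + p * ∫⁻ q, ∫⁻ z, F (q.1, z) ∂π ∂(π ⊗ₘ A))
          + (p * ε + (1 - p) * δ) := by rw [hK A inferInstance]; ring
    _ = _ := by
        rw [← hK B inferInstance, ← hadd, lintegral_add_measure, lintegral_smul_measure,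
          smul_eq_mul]

theorem isMarkovKernel_pow (κ : Kernel α α) [IsMarkovKernel κ] (n : ℕ) :
    IsMarkovKernel (κ ^ n) := by
  induction n with
  | zero => exact inferInstanceAs (IsMarkovKernel Kernel.id)
  | succ n ih => exact inferInstanceAs (IsMarkovKernel ((κ ^ n) ∘ₖ κ))

theorem invariant_pow {κ : Kernel α α} (h : κ.Invariant π) (n : ℕ) : (κ ^ n).Invariant π := by
  induction n with
  | zero => exact Measure.bind_dirac
  | succ n ih => exact ih.comp h

theorem smul_pow_le_pow {Q R : Kernel α α} {a : ℝ≥0∞} (ha : a ≠ ∞) (h : ∀ x, a • Q x ≤ R x)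
    (n : ℕ) (x : α) : a ^ n • (Q ^ n) x ≤ (R ^ n) x := by
  induction n generalizing x with
  | zero => simp
  | succ n ih =>
    refine Measure.le_iff.2 fun s hs => ?_
    change a ^ (n + 1) * ((Q ^ n) ∘ₖ Q) x s ≤ ((R ^ n) ∘ₖ R) x s
    rw [Kernel.comp_apply' _ _ _ hs, Kernel.comp_apply' _ _ _ hs]
    calc a ^ (n + 1) * ∫⁻ y, (Q ^ n) y s ∂Q x
        = ∫⁻ y, a ^ n * (Q ^ n) y s ∂(a • Q x) := by
          rw [lintegral_smul_measure, lintegral_const_mul' _ _ (ENNReal.pow_ne_top ha), pow_succ,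
            smul_eq_mul]
          ring
      _ ≤ ∫⁻ y, (R ^ n) y s ∂(R x) := lintegral_mono' (h x) fun y => ih y s

theorem MixingBound.mono {κ : Kernel α α} {ε δ : ℝ≥0∞} (h : MixingBound π κ ε) (hε : ε ≤ δ) :
    MixingBound π κ δ := fun F hF hF1 => (h F hF hF1).trans (by gcongr)

theorem mixingBound_one [IsProbabilityMeasure π] (κ : Kernel α α) [IsMarkovKernel κ] :
    MixingBound π κ 1 := by
  intro F _ hF1
  calc ∫⁻ x, ∫⁻ y, F (x, y) ∂κ x ∂π ≤ ∫⁻ x, ∫⁻ _, 1 ∂κ x ∂π :=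
        lintegral_mono fun x => lintegral_mono fun y => hF1 _
    _ = 1 := by simp
    _ ≤ _ := le_add_self

/-- If `R` dominates `a • Q` and the powers of `Q` mix, then the powers of `R` mix. -/
theorem exists_mixingBound_pow [StandardBorelSpace α] [Nonempty α] [IsProbabilityMeasure π]
    {Q R : Kernel α α} [IsMarkovKernel Q] [IsMarkovKernel R]
    (hQ : Q.Invariant π) (hR : R.Invariant π) {a : ℝ≥0∞} (ha0 : a ≠ 0) (ha1 : a ≤ 1)
    (hle : ∀ x, a • Q x ≤ R x)
    (hmix : ∀ ε : ℝ≥0∞, 0 < ε → ∃ m : ℕ, MixingBound π (Q ^ m) ε) {ε : ℝ≥0∞} (hε : 0 < ε) :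
    ∃ N : ℕ, ∀ n, N ≤ n → MixingBound π (R ^ n) ε := by
  obtain ⟨m, hm⟩ := hmix (ε / 2) (ENNReal.half_pos hε.ne')
  have ha : a ≠ ∞ := ne_top_of_le_ne_top ENNReal.one_ne_top ha1
  set p := a ^ m
  have hp0 : p ≠ 0 := pow_ne_zero _ ha0
  have hp1 : p ≤ 1 := pow_le_one₀ zero_le ha1
  have hpt : p ≠ ∞ := ENNReal.pow_ne_top ha
  have := isMarkovKernel_pow Q
  have := isMarkovKernel_pow R
  have hpow : ∀ k : ℕ, MixingBound π (R ^ (k * m)) (ε / 2 + (1 - p) ^ k) := by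
    intro k
    induction k with
    | zero => exact (mixingBound_one _).mono (by simp)
    -- The bound is stable under the recursion: `p (ε/2) + (1 - p) (ε/2 + (1 - p) ^ k) = ε/2 + (1 -
    -- p) ^ (k + 1)`.
    | succ k ih =>
      have h := MixingBound.comp_of_smul_le (invariant_pow hR (k * m)) (invariant_pow hQ m)
        (invariant_pow hR m) hpt (smul_pow_le_pow ha hle m) hm ih
      rw [add_one_mul, pow_add]
      refine MixingBound.mono h (le_of_eq ?_)
      rw [mul_add, ← add_assoc, ← add_mul, add_tsub_cancel_of_le hp1, one_mul, ← pow_succ']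
  have hlim : Tendsto (fun k : ℕ => (1 - p) ^ k) atTop (𝓝 0) :=
    ENNReal.tendsto_pow_atTop_nhds_zero_of_lt_one
      (ENNReal.sub_lt_self ENNReal.one_ne_top one_ne_zero hp0)
  obtain ⟨k, hk⟩ := (hlim.eventually (ge_mem_nhds (ENNReal.half_pos hε.ne'))).exists
  refine ⟨k * m, fun n hn => ?_⟩
  obtain ⟨l, rfl⟩ := Nat.exists_eq_add_of_le' hn
  rw [pow_add]
  refine ((hpow k).mono ?_).comp_left (invariant_pow hR l)
  calc ε / 2 + (1 - p) ^ k ≤ ε / 2 + ε / 2 := by gcongr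
    _ = ε := ENNReal.add_halves ε

end Kernels

/-! ### Conditional densities of events given a random variable -/

section Density

variable {Ω β : Type*} [MeasurableSpace Ω] [MeasurableSpace β] {P : Measure Ω}

/-- `g` is a version of `P(A | Y = ·)`. -/
def IsCondDensity (P : Measure Ω) (Y : Ω → β) (A : Set Ω) (g : β → ℝ≥0∞) : Prop :=
  Measurable g ∧ ∀ φ : β → ℝ≥0∞, Measurable φ →
    ∫⁻ ω in A, φ (Y ω) ∂P = ∫⁻ y, g y * φ y ∂(P.map Y)

theorem isCondDensity_rnDeriv [IsFiniteMeasure P] {Y : Ω → β} (hY : Measurable Y) (A : Set Ω) :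
    IsCondDensity P Y A (((P.restrict A).map Y).rnDeriv (P.map Y)) := by
  refine ⟨Measure.measurable_rnDeriv _ _, fun φ hφ => ?_⟩
  have hac : (P.restrict A).map Y ≪ P.map Y :=
    Measure.absolutelyContinuous_of_le (Measure.map_mono Measure.restrict_le_self hY)
  rw [← lintegral_map hφ hY]
  conv_lhs => rw [← Measure.withDensity_rnDeriv_eq _ _ hac]
  rw [lintegral_withDensity_eq_lintegral_mul _ (Measure.measurable_rnDeriv _ _) hφ]
  rfl

theorem IsCondDensity.congr {Y : Ω → β} {A : Set Ω} {g g' : β → ℝ≥0∞}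
    (h : IsCondDensity P Y A g) (hg' : Measurable g') (hgg' : g =ᵐ[P.map Y] g') :
    IsCondDensity P Y A g' := by
  refine ⟨hg', fun φ hφ => (h.2 φ hφ).trans (lintegral_congr_ae ?_)⟩
  filter_upwards [hgg'] with y hy
  rw [hy]

theorem IsCondDensity.lintegral {Y : Ω → β} {A : Set Ω} {g : β → ℝ≥0∞}
    (h : IsCondDensity P Y A g) : ∫⁻ y, g y ∂(P.map Y) = P A := by
  have := h.2 1 measurable_one
  simpa using this.symm

/-- The conditional densities of a finite partition can be chosen as a subpartition of unity. -/
theorem exists_isCondDensity_sum_le_one [IsFiniteMeasure P] {Y : Ω → β} (hY : Measurable Y)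
    {n : ℕ} (A : Fin n → Set Ω) (hA : ∀ i, MeasurableSet (A i))
    (hd : Pairwise fun i i' => Disjoint (A i) (A i')) :
    ∃ g : Fin n → β → ℝ≥0∞, (∀ i, IsCondDensity P Y (A i) (g i)) ∧ ∀ y, ∑ i, g i y ≤ 1 := by
  set d : Fin n → β → ℝ≥0∞ := fun i => ((P.restrict (A i)).map Y).rnDeriv (P.map Y)
  have hd' : ∀ i, IsCondDensity P Y (A i) (d i) := fun i => isCondDensity_rnDeriv hY (A i)
  have hle : (fun y => ∑ i, d i y) ≤ᵐ[P.map Y] fun _ => 1 := by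
    -- Over a set `s` the densities integrate to `P (A i ∩ Y ⁻¹' s)`; by disjointness these add up
    -- to at most `P (Y ∈ s)`.
    refine ae_le_of_forall_setLIntegral_le_of_sigmaFinite
      (Finset.measurable_sum _ fun i _ => (hd' i).1) fun s hs _ => ?_
    rw [lintegral_finsetSum _ fun i _ => (hd' i).1]
    have h1 : ∀ i, ∫⁻ y in s, d i y ∂(P.map Y) = P (A i ∩ Y ⁻¹' s) := by
      intro i
      have := (hd' i).2 (s.indicator 1) (measurable_one.indicator hs)
      have hcomp : (fun ω => s.indicator (1 : β → ℝ≥0∞) (Y ω))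
          = (Y ⁻¹' s).indicator 1 := rfl
      rw [hcomp, lintegral_indicator_one (hY hs), Measure.restrict_apply (hY hs)] at this
      rw [Set.inter_comm, this, ← lintegral_indicator hs]
      refine lintegral_congr fun y => ?_
      by_cases hy : y ∈ s <;> simp [hy]
    simp_rw [h1]
    rw [← tsum_fintype (L := .unconditional _), ← measure_iUnion]
    · rw [lintegral_one, Measure.restrict_apply_univ, Measure.map_apply hY hs]
      exact measure_mono (Set.iUnion_subset fun i => Set.inter_subset_right)
    · exact fun i i' hii' => (hd hii').mono Set.inter_subset_left Set.inter_subset_left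
    · exact fun i => (hA i).inter (hY hs)
  -- Zeroing the densities off this set of full measure makes the bound hold everywhere, as test
  -- functions in `MixingBound` require.
  set S : Set β := {y | ∑ i, d i y ≤ 1}
  have hS : MeasurableSet S :=
    measurableSet_le (Finset.measurable_sum _ fun i _ => (hd' i).1) measurable_const
  refine ⟨fun i => S.indicator (d i), fun i => (hd' i).congr ((hd' i).1.indicator hS) ?_,
    fun y => ?_⟩
  · filter_upwards [hle] with y hy
    exact (Set.indicator_of_mem (s := S) hy _).symm
  · by_cases hy : y ∈ S
    · simp only [Set.indicator_of_mem hy]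
      exact hy
    · simp [hy]

end Density

/-! ### The past filtration -/

section Filtration

variable {Ω : Type*}

theorem past_mono (X : ℤ → Ω → ℝ) {m n : ℤ} (h : m ≤ n) : past X m ≤ past X n :=
  iSup₂_le fun k hk => le_iSup₂_of_le k (hk.trans h) le_rfl

theorem comap_le_past (X : ℤ → Ω → ℝ) (n : ℤ) :
    MeasurableSpace.comap (X n) inferInstance ≤ past X n :=
  le_iSup₂_of_le n le_rfl le_rfl

theorem measurable_past (X : ℤ → Ω → ℝ) (n : ℤ) : Measurable[past X n] (X n) :=
  Measurable.of_comap_le (comap_le_past X n)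

theorem measurable_indicator_one {m : MeasurableSpace Ω} {A : Set Ω} (hA : MeasurableSet[m] A) :
    Measurable[m] (A.indicator (1 : Ω → ℝ≥0∞)) :=
  measurable_one.indicator hA

end Filtration

/-! ### Markov property in terms of the transition kernel -/

section Chain

variable {Ω : Type*} [MeasurableSpace Ω] {P : Measure Ω} {X : ℤ → Ω → ℝ}

theorem IsStationaryMarkovChain.past_le (h : IsStationaryMarkovChain P X) (n : ℤ) :
    past X n ≤ ‹MeasurableSpace Ω› :=
  iSup₂_le fun k _ => (h.measurable k).comap_le

theorem IsStationaryMarkovChain.future_le (h : IsStationaryMarkovChain P X) (n : ℤ) :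
    future X n ≤ ‹MeasurableSpace Ω› :=
  iSup₂_le fun k _ => (h.measurable k).comap_le

theorem IsStationaryMarkovChain.map_pair (h : IsStationaryMarkovChain P X) (n : ℤ) :
    P.map (fun ω => (X n ω, X (n + 1) ω)) = P.map (fun ω => (X 0 ω, X 1 ω)) := by
  have hX := h.measurable
  have step : ∀ n : ℤ, P.map (fun ω => (X (n + 1) ω, X (n + 1 + 1) ω))
      = P.map (fun ω => (X n ω, X (n + 1) ω)) := by
    intro n
    have hpr : Measurable fun x : ℤ → ℝ => (x n, x (n + 1)) := by fun_prop
    have := congrArg (Measure.map fun x : ℤ → ℝ => (x n, x (n + 1))) h.stationary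
    rw [Measure.map_map hpr (by fun_prop), Measure.map_map hpr (by fun_prop)] at this
    exact this
  induction n using Int.induction_on with
  | zero => simp
  | succ i ih => rw [step, ih]
  | pred i ih =>
    rw [← ih, ← step (-(i : ℤ) - 1)]
    simp

theorem IsStationaryMarkovChain.map_eq (h : IsStationaryMarkovChain P X) (n : ℤ) :
    P.map (X n) = P.map (X 0) := by
  have hX := h.measurable
  have := congrArg (Measure.map Prod.fst) (h.map_pair n)
  rw [Measure.map_map measurable_fst (by fun_prop), Measure.map_map measurable_fst (by fun_prop)]
    at this
  exact this

/-- `X` is a stationary Markov chain with transition kernel `κ`. -/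
structure HasTransition (P : Measure Ω) (X : ℤ → Ω → ℝ) (κ : Kernel ℝ ℝ) : Prop where
  chain : IsStationaryMarkovChain P X
  law : P.map (fun ω => (X 0 ω, X 1 ω)) = P.map (X 0) ⊗ₘ κ

variable [IsProbabilityMeasure P] {κ : Kernel ℝ ℝ} [IsMarkovKernel κ]

/-- By stationarity and uniqueness of disintegrations, `κ` is the conditional law of `X (n + 1)`
given `X n`; the Markov property makes it the conditional law given the whole past. -/
theorem HasTransition.measure_inter (h : HasTransition P X κ) (n : ℤ) {A : Set Ω}
    (hA : MeasurableSet[past X n] A) {B : Set ℝ} (hB : MeasurableSet B) :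
    P (A ∩ X (n + 1) ⁻¹' B) = ∫⁻ ω in A, κ (X n ω) B ∂P := by
  have hX := h.chain.measurable
  have hm := h.chain.past_le n
  have hlaw : P.map (fun ω => (X n ω, X (n + 1) ω)) = P.map (X n) ⊗ₘ κ := by
    rw [h.chain.map_pair, h.law, h.chain.map_eq n]
  have hcd := ae_of_ae_map (hX n).aemeasurable
    (condDistrib_ae_eq_of_measure_eq_compProd (X n) (hX (n + 1)).aemeasurable hlaw)
  have hce := condDistrib_ae_eq_condExp (μ := P) (hX n) (hX (n + 1)) hB
  have hint : Integrable ((X (n + 1) ⁻¹' B).indicator fun _ => (1 : ℝ)) P :=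
    (integrable_const _).indicator (hX (n + 1) hB)
  have h1 : (fun ω => (κ (X n ω)).real B) =ᵐ[P]
      P[(X (n + 1) ⁻¹' B).indicator (fun _ => (1 : ℝ)) | past X n] := by
    filter_upwards [hcd, hce, h.chain.markov n B hB] with ω h1 h2 h3
    rw [h3, ← h2, h1]
  have h2 : ∫ ω in A, (κ (X n ω)).real B ∂P = P.real (A ∩ X (n + 1) ⁻¹' B) := by
    rw [setIntegral_congr_ae (hm _ hA) (h1.mono fun ω hω _ => hω),
      setIntegral_condExp hm hint hA, setIntegral_indicator (hX (n + 1) hB)]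
    simp
  have hmeas : Measurable fun ω => κ (X n ω) B := (κ.measurable_coe hB).comp (hX n)
  simp only [Measure.real] at h2
  rw [integral_toReal hmeas.aemeasurable (Eventually.of_forall fun ω => measure_lt_top _ _)] at h2
  refine ((ENNReal.toReal_eq_toReal_iff' ?_ (measure_ne_top _ _)).1 h2).symm
  refine ne_top_of_le_ne_top (measure_ne_top P A) ?_
  calc ∫⁻ ω in A, κ (X n ω) B ∂P ≤ ∫⁻ _ in A, 1 ∂P := lintegral_mono fun ω => prob_le_one
    _ = P A := by simp

theorem HasTransition.lintegral_succ (h : HasTransition P X κ) (n : ℤ) {f : Ω → ℝ≥0∞}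
    (hf : Measurable[past X n] f) {φ : ℝ → ℝ≥0∞} (hφ : Measurable φ) :
    ∫⁻ ω, f ω * φ (X (n + 1) ω) ∂P = ∫⁻ ω, f ω * ∫⁻ y, φ y ∂κ (X n ω) ∂P := by
  have hX := h.chain.measurable
  have hm := h.chain.past_le n
  have hf' : Measurable f := hf.mono hm le_rfl
  have hset : ∀ B : Set ℝ, MeasurableSet B →
      ∫⁻ ω in X (n + 1) ⁻¹' B, f ω ∂P = ∫⁻ ω, f ω * κ (X n ω) B ∂P := by
    intro B hB
    have hmeas : Measurable fun ω => κ (X n ω) B := (κ.measurable_coe hB).comp (hX n)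
    -- Passing from events to functions `f` of the past amounts to equality of two measures on the
    -- past σ-algebra; `hmap` below does the same for `φ`.
    have htrim : (P.restrict (X (n + 1) ⁻¹' B)).trim hm
        = (P.withDensity fun ω => κ (X n ω) B).trim hm := by
      refine @Measure.ext _ (past X n) _ _ fun A hA => ?_
      rw [trim_measurableSet_eq hm hA, trim_measurableSet_eq hm hA,
        Measure.restrict_apply (hm _ hA), withDensity_apply _ (hm _ hA), h.measure_inter n hA hB]
    rw [← lintegral_trim hm hf, htrim, lintegral_trim hm hf,
      lintegral_withDensity_eq_lintegral_mul _ hmeas hf']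
    refine lintegral_congr fun ω => mul_comm _ _
  have hmap : (P.withDensity f).map (X (n + 1)) = ((P.withDensity f).map (X n)).bind κ := by
    ext B hB
    rw [Measure.map_apply (hX _) hB, withDensity_apply _ (hX _ hB), hset B hB,
      Measure.bind_apply hB κ.aemeasurable, lintegral_map (κ.measurable_coe hB) (hX n),
      lintegral_withDensity_eq_lintegral_mul (g := fun ω => κ (X n ω) B) _ hf' ((κ.measurable_coe hB).comp (hX n))]
    rfl
  have := congrArg (fun μ : Measure ℝ => ∫⁻ y, φ y ∂μ) hmap
  rw [lintegral_map hφ (hX _), Measure.lintegral_bind κ.aemeasurable hφ.aemeasurable,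
    lintegral_map hφ.lintegral_kernel (hX n),
    lintegral_withDensity_eq_lintegral_mul (g := fun ω => φ (X (n + 1) ω)) _ hf'
      (hφ.comp (hX _)),
    lintegral_withDensity_eq_lintegral_mul (g := fun ω => ∫⁻ y, φ y ∂κ (X n ω)) _ hf'
      (hφ.lintegral_kernel.comp (hX n))] at this
  exact this

theorem HasTransition.lintegral_add (h : HasTransition P X κ) (n : ℤ) {f : Ω → ℝ≥0∞}
    (hf : Measurable[past X n] f) (m : ℕ) {φ : ℝ → ℝ≥0∞} (hφ : Measurable φ) :
    ∫⁻ ω, f ω * φ (X (n + m) ω) ∂P = ∫⁻ ω, f ω * ∫⁻ y, φ y ∂(κ ^ m) (X n ω) ∂P := by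
  induction m generalizing φ with
  | zero =>
    refine lintegral_congr fun ω => ?_
    have : ∫⁻ y, φ y ∂(κ ^ 0) (X n ω) = φ (X n ω) := lintegral_dirac' _ hφ
    rw [this, Nat.cast_zero, add_zero]
  | succ m ih =>
    have := h.lintegral_succ (n + m) (hf.mono (past_mono X (by simp)) le_rfl) hφ
    rw [Nat.cast_add_one, ← add_assoc, this, ih hφ.lintegral_kernel]
    refine lintegral_congr fun ω => ?_
    rw [pow_succ']
    exact congrArg _ (Kernel.lintegral_comp κ (κ ^ m) _ hφ).symm

/-- Conditionally on the past up to time `n`, a product of functions of the present and the future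
integrates to a function of `X n` only. -/
theorem HasTransition.exists_lintegral_prod (h : HasTransition P X κ) (K : ℕ)
    (φ : ℕ → ℝ → ℝ≥0∞) (hφ : ∀ i, Measurable (φ i)) :
    ∃ H : ℝ → ℝ≥0∞, Measurable H ∧ ∀ (n : ℤ) (f : Ω → ℝ≥0∞), Measurable[past X n] f →
      ∫⁻ ω, f ω * ∏ i ∈ Finset.range K, φ i (X (n + i) ω) ∂P = ∫⁻ ω, f ω * H (X n ω) ∂P := by
  induction K generalizing φ with
  | zero => exact ⟨1, measurable_one, fun n f _ => by simp⟩
  | succ K ih =>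
    obtain ⟨H, hH, hHf⟩ := ih (fun i => φ (i + 1)) fun i => hφ _
    -- The function is fixed before `f`, so the same one serves different weights on the past.
    refine ⟨fun x => φ 0 x * ∫⁻ y, H y ∂κ x, (hφ 0).mul hH.lintegral_kernel, fun n f hf => ?_⟩
    have hf0 : Measurable[past X n] fun ω => f ω * φ 0 (X n ω) :=
      hf.mul ((hφ 0).comp (measurable_past X n))
    have h1 := hHf (n + 1) _ (hf0.mono (past_mono X (by simp)) le_rfl)
    rw [h.lintegral_succ n hf0 hH] at h1
    calc ∫⁻ ω, f ω * ∏ i ∈ Finset.range (K + 1), φ i (X (n + i) ω) ∂P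
        = ∫⁻ ω, f ω * φ 0 (X n ω) *
            ∏ i ∈ Finset.range K, φ (i + 1) (X (n + 1 + i) ω) ∂P := by
          refine lintegral_congr fun ω => ?_
          rw [Finset.prod_range_succ']
          have : ∀ i : ℕ, n + ((i + 1 : ℕ) : ℤ) = n + 1 + i := fun i => by push_cast; ring
          simp only [this, Nat.cast_zero, add_zero]
          ring
      _ = _ := h1
      _ = _ := lintegral_congr fun ω => by ring

/-- The Markov property for events of the whole future. -/
theorem HasTransition.measure_inter_future (h : HasTransition P X κ) (n : ℤ) {A B : Set Ω}
    (hA : MeasurableSet[past X n] A) (hB : MeasurableSet[future X n] B) {g : ℝ → ℝ≥0∞}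
    (hg : IsCondDensity P (X n) A g) : P (A ∩ B) = ∫⁻ ω in B, g (X n ω) ∂P := by
  have hX := h.chain.measurable
  have hpm := h.chain.past_le n
  have hfm := h.chain.future_le n
  have hgX : Measurable fun ω => g (X n ω) := hg.1.comp (hX n)
  have hfin : ∫⁻ ω, g (X n ω) ∂P = P A := by
    rw [← lintegral_map hg.1 (hX n), hg.lintegral]
  -- Two finite measures on the future σ-algebra, compared on the π-system of finite-dimensional
  -- cylinders.
  have key : (P.restrict A).trim hfm = (P.withDensity fun ω => g (X n ω)).trim hfm := by
    have : @IsFiniteMeasure _ (future X n) ((P.restrict A).trim hfm) :=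
      isFiniteMeasure_trim hfm
    refine @ext_of_generate_finite Ω (future X n) _ _ _
      (generateFrom_piiUnionInter_measurableSet
        (fun k => MeasurableSpace.comap (X k) inferInstance) (Set.Ici n)).symm
      (isPiSystem_piiUnionInter _ (fun k => @MeasurableSpace.isPiSystem_measurableSet _
        (MeasurableSpace.comap (X k) inferInstance)) _) this ?_ ?_
    · rintro s ⟨t, ht, u, hu, rfl⟩
      choose! v hv hvu using hu
      have hs : MeasurableSet[future X n] (⋂ k ∈ t, u k) :=
        Finset.measurableSet_biInter _ fun k hk =>
          (le_iSup₂_of_le (f := fun (k : ℤ) (_ : n ≤ k) =>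
            MeasurableSpace.comap (X k) inferInstance) k (ht hk) le_rfl :
            MeasurableSpace.comap (X k) inferInstance ≤ future X n) _ ⟨v k, hv k hk, hvu k hk⟩
      rw [trim_measurableSet_eq hfm hs, trim_measurableSet_eq hfm hs,
        Measure.restrict_apply (hfm _ hs), withDensity_apply _ (hfm _ hs)]
      classical
      -- Times not constrained by the cylinder get the factor `1`, so its indicator is a product
      -- over consecutive times.
      set φ : ℕ → ℝ → ℝ≥0∞ := fun i =>
        if n + (i : ℤ) ∈ t then (v (n + i)).indicator 1 else 1
      have hφ : ∀ i, Measurable (φ i) := by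
        intro i
        simp only [φ]
        split_ifs with hi
        · exact measurable_one.indicator (hv _ hi)
        · exact measurable_one
      obtain ⟨K, hK⟩ : ∃ K : ℕ, ∀ k ∈ t, k < n + K := by
        obtain ⟨M, hM⟩ := t.exists_le
        refine ⟨(M - n).toNat + 1, fun k hk => ?_⟩
        have := hM k hk
        push_cast
        omega
      have hind : ∀ ω, ∏ i ∈ Finset.range K, φ i (X (n + i) ω)
          = (⋂ k ∈ t, u k).indicator (1 : Ω → ℝ≥0∞) ω := by
        intro ω
        by_cases hω : ω ∈ ⋂ k ∈ t, u k
        · rw [Set.indicator_of_mem hω, Pi.one_apply]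
          refine Finset.prod_eq_one fun i _ => ?_
          simp only [φ]
          split_ifs with hi
          · have h1 : ω ∈ u (n + i) := Set.mem_iInter₂.1 hω _ hi
            rw [← hvu _ hi] at h1
            exact Set.indicator_of_mem (s := v (n + i)) h1 _
          · rfl
        · rw [Set.indicator_of_notMem hω]
          simp only [Set.mem_iInter, not_forall] at hω
          obtain ⟨k, hk, hωk⟩ := hω
          have hnk : n ≤ k := ht hk
          have hkK := hK k hk
          obtain ⟨i, rfl⟩ := Int.le.dest hnk
          refine Finset.prod_eq_zero (i := i) (Finset.mem_range.2 (by omega)) ?_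
          simp only [φ, if_pos hk]
          rw [← hvu _ hk] at hωk
          exact Set.indicator_of_notMem (s := v (n + i)) hωk _
      obtain ⟨H, hH, hHf⟩ := h.exists_lintegral_prod K φ hφ
      have e1 := hHf n (A.indicator 1) (measurable_indicator_one hA)
      have e2 := hHf n (fun ω => g (X n ω)) (hg.1.comp (measurable_past X n))
      simp only [hind] at e1 e2
      -- Against functions of `X n` alone, the indicator of `A` and its conditional density are
      -- interchangeable.
      have e3 : ∫⁻ ω, A.indicator 1 ω * H (X n ω) ∂P = ∫⁻ ω, g (X n ω) * H (X n ω) ∂P := by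
        rw [← lintegral_map (f := fun x => g x * H x) (hg.1.mul hH) (hX n), ← hg.2 H hH,
          ← lintegral_indicator (hpm _ hA)]
        refine lintegral_congr fun ω => ?_
        by_cases hω : ω ∈ A <;> simp [hω]
      rw [Set.inter_comm, ← lintegral_indicator_one ((hpm _ hA).inter (hfm _ hs)),
        ← lintegral_indicator (hfm _ hs)]
      refine Eq.trans (lintegral_congr fun ω => ?_)
        ((e1.trans (e3.trans e2.symm)).trans (lintegral_congr fun ω => ?_))
      · rw [Set.inter_indicator_one]; rfl
      · by_cases hω : ω ∈ ⋂ k ∈ t, u k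
        · rw [Set.indicator_of_mem hω, Set.indicator_of_mem hω, Pi.one_apply, mul_one]
        · rw [Set.indicator_of_notMem hω, Set.indicator_of_notMem hω, mul_zero]
    · rw [trim_measurableSet_eq hfm MeasurableSet.univ, trim_measurableSet_eq hfm MeasurableSet.univ,
        withDensity_apply _ MeasurableSet.univ, Measure.restrict_univ, hfin,
        Measure.restrict_apply_univ]
  have := congrArg (fun μ => @DFunLike.coe _ _ _ (@Measure.instFunLike _ (future X n)) μ B) key
  rw [trim_measurableSet_eq hfm hB, trim_measurableSet_eq hfm hB,
    Measure.restrict_apply (hfm _ hB), withDensity_apply _ (hfm _ hB)] at this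
  rw [Set.inter_comm, this]

/-- Events of the past and of the future, through the `m`-step transition kernel. -/
theorem HasTransition.measure_past_inter_future (h : HasTransition P X κ) (m : ℕ) {A B : Set Ω}
    (hA : MeasurableSet[past X 0] A) (hB : MeasurableSet[future X m] B) {f g : ℝ → ℝ≥0∞}
    (hf : IsCondDensity P (X 0) A f) (hg : IsCondDensity P (X m) B g) :
    P (A ∩ B) = ∫⁻ x, ∫⁻ y, f x * g y ∂(κ ^ m) x ∂(P.map (X 0)) := by
  have hX := h.chain.measurable
  have := isMarkovKernel_pow κ m
  have hA' := past_mono X (Int.natCast_nonneg m) _ hA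
  have hAm := h.chain.past_le _ _ hA
  -- `A` also belongs to the past of time `m`. Its density given `X m` reduces `B` to `g`, after
  -- which the `m`-step transition carries `g (X m)` back to time `0`.
  have hd := isCondDensity_rnDeriv (P := P) (hX m) A
  have hind : Measurable[past X 0] (A.indicator (1 : Ω → ℝ≥0∞)) := measurable_indicator_one hA
  have h1 := h.lintegral_add 0 hind m hg.1
  rw [zero_add] at h1
  have h2 : ∀ ψ : Ω → ℝ≥0∞, ∫⁻ ω, A.indicator 1 ω * ψ ω ∂P = ∫⁻ ω in A, ψ ω ∂P := by
    intro ψ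
    rw [← lintegral_indicator hAm]
    refine lintegral_congr fun ω => ?_
    by_cases hω : ω ∈ A <;> simp [hω]
  rw [h2, h2, hd.2 _ hg.1, hf.2 (fun x => ∫⁻ y, g y ∂(κ ^ m) x) hg.1.lintegral_kernel] at h1
  rw [h.measure_inter_future m hA' hB hd, hg.2 _ hd.1]
  simp_rw [mul_comm (g _)]
  rw [h1]
  exact lintegral_congr fun x => (lintegral_const_mul _ hg.1).symm

theorem HasTransition.map_pair_pow (h : HasTransition P X κ) (m : ℕ) :
    P.map (fun ω => (X 0 ω, X m ω)) = P.map (X 0) ⊗ₘ (κ ^ m) := by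
  have hX := h.chain.measurable
  have := isMarkovKernel_pow κ m
  have : IsProbabilityMeasure (P.map (X 0)) := Measure.isProbabilityMeasure_map (hX 0).aemeasurable
  refine Measure.ext_prod fun {s t} hs ht => ?_
  have h1 := h.lintegral_add 0 (f := (X 0 ⁻¹' s).indicator 1)
    (measurable_indicator_one (measurable_past X 0 hs)) m (φ := t.indicator 1)
    (measurable_one.indicator ht)
  rw [zero_add] at h1
  have h2 : ∀ ω, (X 0 ⁻¹' s).indicator (1 : Ω → ℝ≥0∞) ω * t.indicator 1 (X m ω)
      = (X 0 ⁻¹' s ∩ X m ⁻¹' t).indicator 1 ω := fun ω => by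
    rw [Set.inter_indicator_one]; rfl
  simp only [h2, lintegral_indicator_one ht] at h1
  rw [lintegral_indicator_one ((hX 0 hs).inter (hX m ht))] at h1
  rw [Measure.map_apply (by fun_prop) (hs.prod ht), Measure.compProd_apply_prod hs ht,
    setLIntegral_map hs ((κ ^ m).measurable_coe ht) (hX 0), ← lintegral_indicator (hX 0 hs)]
  refine h1.trans (lintegral_congr fun ω => ?_)
  by_cases hω : ω ∈ X 0 ⁻¹' s <;> simp [hω]

end Chain

/-! ### Measurable partitions and the coefficient β -/

section Filtration

variable {Ω : Type*}

theorem IsMeasurablePartition.mono {𝒜 ℬ : MeasurableSpace Ω} {n : ℕ} {A : Fin n → Set Ω}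
    (hA : IsMeasurablePartition 𝒜 A) (h : 𝒜 ≤ ℬ) :
    IsMeasurablePartition ℬ A :=
  ⟨fun i => h _ (hA.measurable i), hA.disjoint, hA.cover⟩

theorem comap_le_future (X : ℤ → Ω → ℝ) (n : ℤ) :
    MeasurableSpace.comap (X n) inferInstance ≤ future X n :=
  le_iSup₂_of_le n le_rfl le_rfl

theorem isMeasurablePartition_preimage {𝒜 : MeasurableSpace Ω} {n : ℕ} {Y : Ω → ℝ}
    (hY : Measurable[𝒜] Y) {p : ℝ → Fin n} (hp : Measurable p) :
    IsMeasurablePartition 𝒜 fun i => Y ⁻¹' (p ⁻¹' {i}) where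
  measurable i := hY (hp (measurableSet_singleton i))
  disjoint _ _ h := Set.disjoint_left.2 fun _ h1 h2 => h (h1.symm.trans h2)
  cover := Set.eq_univ_of_forall fun ω => Set.mem_iUnion.2 ⟨p (Y ω), rfl⟩

theorem betaCoeff_nonneg {𝒜 ℬ : MeasurableSpace Ω} [MeasurableSpace Ω] {P : Measure Ω} :
    0 ≤ betaCoeff P 𝒜 ℬ := by
  refine mul_nonneg (by norm_num) (Real.sSup_nonneg ?_)
  rintro s ⟨n, m, A, B, -, -, rfl⟩
  positivity

end Filtration

section Partition

variable {Ω : Type*} {𝒜 ℬ : MeasurableSpace Ω} [mΩ : MeasurableSpace Ω] {P : Measure Ω}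
  [IsProbabilityMeasure P] {n m : ℕ} {A : Fin n → Set Ω} {B : Fin m → Set Ω}

theorem IsMeasurablePartition.sum_inter (hA : IsMeasurablePartition mΩ A) (S : Set Ω) :
    ∑ i, P.real (A i ∩ S) = P.real S := by
  rw [← tsum_fintype (L := .unconditional _)]
  have h := measureReal_iUnion_fintype (μ := P.restrict S) hA.disjoint hA.measurable
  simp only [measureReal_restrict_apply (hA.measurable _), hA.cover,
    measureReal_restrict_apply MeasurableSet.univ, Set.univ_inter] at h
  rw [tsum_fintype, h]

theorem IsMeasurablePartition.sum (hA : IsMeasurablePartition mΩ A) :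
    ∑ i, P.real (A i) = 1 := by
  simpa using hA.sum_inter (P := P) Set.univ

theorem IsMeasurablePartition.sum_sum_inter (hA : IsMeasurablePartition mΩ A)
    (hB : IsMeasurablePartition mΩ B) : ∑ i, ∑ j, P.real (A i ∩ B j) = 1 := by
  rw [Finset.sum_comm]
  simp_rw [hA.sum_inter]
  exact hB.sum

theorem IsMeasurablePartition.sum_sum_mul (hA : IsMeasurablePartition mΩ A)
    (hB : IsMeasurablePartition mΩ B) : ∑ i, ∑ j, P.real (A i) * P.real (B j) = 1 := by
  simp_rw [← Finset.mul_sum, hB.sum, mul_one]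
  exact hA.sum

theorem sum_abs_le_betaCoeff (h𝒜 : 𝒜 ≤ mΩ) (hℬ : ℬ ≤ mΩ) (hA : IsMeasurablePartition 𝒜 A)
    (hB : IsMeasurablePartition ℬ B) :
    ∑ i, ∑ j, |P.real (A i ∩ B j) - P.real (A i) * P.real (B j)| ≤ 2 * betaCoeff P 𝒜 ℬ := by
  rw [betaCoeff, ← mul_assoc, mul_one_div_cancel two_ne_zero, one_mul]
  -- The upper bound `2` is needed: the real `sSup` of an unbounded set is `0`.
  refine le_csSup ⟨2, ?_⟩ ⟨n, m, A, B, hA, hB, rfl⟩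
  rintro s ⟨n, m, A, B, hA, hB, rfl⟩
  calc ∑ i, ∑ j, |P.real (A i ∩ B j) - P.real (A i) * P.real (B j)|
      ≤ ∑ i, ∑ j, (P.real (A i ∩ B j) + P.real (A i) * P.real (B j)) := by
        refine Finset.sum_le_sum fun i _ => Finset.sum_le_sum fun j _ => ?_
        refine (abs_sub _ _).trans (le_of_eq ?_)
        rw [abs_of_nonneg measureReal_nonneg,
          abs_of_nonneg (mul_nonneg measureReal_nonneg measureReal_nonneg)]
    _ = 2 := by
        simp_rw [Finset.sum_add_distrib]
        rw [(hA.mono h𝒜).sum_sum_inter (hB.mono hℬ), (hA.mono h𝒜).sum_sum_mul (hB.mono hℬ)]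
        norm_num

/-- It suffices to bound the sums of the positive parts. -/
theorem betaCoeff_le {ε : ℝ} (hε : 0 ≤ ε) (h𝒜 : 𝒜 ≤ mΩ) (hℬ : ℬ ≤ mΩ)
    (h : ∀ (n m : ℕ) (A : Fin n → Set Ω) (B : Fin m → Set Ω), IsMeasurablePartition 𝒜 A →
      IsMeasurablePartition ℬ B → ∀ S : Finset (Fin n × Fin m),
      ∑ c ∈ S, P.real (A c.1 ∩ B c.2) ≤ ∑ c ∈ S, P.real (A c.1) * P.real (B c.2) + ε) :
    betaCoeff P 𝒜 ℬ ≤ ε := by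
  have : sSup {s : ℝ | ∃ (n m : ℕ) (A : Fin n → Set Ω) (B : Fin m → Set Ω),
      IsMeasurablePartition 𝒜 A ∧ IsMeasurablePartition ℬ B ∧
      s = ∑ i, ∑ j, |P.real (A i ∩ B j) - P.real (A i) * P.real (B j)|} ≤ 2 * ε := by
    refine Real.sSup_le ?_ (by positivity)
    rintro s ⟨n, m, A, B, hA, hB, rfl⟩
    classical
    set d : Fin n × Fin m → ℝ := fun c => P.real (A c.1 ∩ B c.2) - P.real (A c.1) * P.real (B c.2)
    -- Both families of cell masses sum to `1`, so the absolute sum is twice the sum of the positive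
    -- parts.
    have h0 : ∑ c, d c = 0 := by
      simp only [d, Finset.sum_sub_distrib, Fintype.sum_prod_type]
      rw [(hA.mono h𝒜).sum_sum_inter (hB.mono hℬ), (hA.mono h𝒜).sum_sum_mul (hB.mono hℬ), sub_self]
    have hS := h n m A B hA hB (Finset.univ.filter fun c => 0 ≤ d c)
    have hpos : ∑ c with 0 ≤ d c, d c ≤ ε := by
      simp only [d, Finset.sum_sub_distrib] at hS ⊢
      linarith
    calc ∑ i, ∑ j, |P.real (A i ∩ B j) - P.real (A i) * P.real (B j)|
        = ∑ c, |d c| := by rw [Fintype.sum_prod_type]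
      _ = ∑ c, (2 * (if 0 ≤ d c then d c else 0) - d c) := by
          refine Finset.sum_congr rfl fun c _ => ?_
          split_ifs with hc
          · rw [abs_of_nonneg hc]; ring
          · rw [abs_of_neg (not_le.1 hc)]; ring
      _ = 2 * ∑ c with 0 ≤ d c, d c := by
          rw [Finset.sum_sub_distrib, h0, ← Finset.mul_sum, Finset.sum_filter, sub_zero]
      _ ≤ 2 * ε := by linarith
  rw [betaCoeff]
  linarith

end Partition

/-! ### From finite grids to measurable sets and to functions -/

section Rectangles

variable {α β : Type*} [MeasurableSpace α] [MeasurableSpace β]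

/-- The sets which are finite unions of cells of a product of two finite partitions. -/
def gridSets (α β : Type*) [MeasurableSpace α] [MeasurableSpace β] : Set (Set (α × β)) :=
  {E | ∃ (n m : ℕ) (p : α → Fin n) (q : β → Fin m) (S : Set (Fin n × Fin m)),
    Measurable p ∧ Measurable q ∧ E = Prod.map p q ⁻¹' S}

theorem isSetAlgebra_gridSets : IsSetAlgebra (gridSets α β) where
  empty_mem := ⟨1, 1, fun _ => 0, fun _ => 0, ∅, measurable_const, measurable_const, rfl⟩
  compl_mem := by
    rintro _ ⟨n, m, p, q, S, hp, hq, rfl⟩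
    exact ⟨n, m, p, q, Sᶜ, hp, hq, rfl⟩
  union_mem := by
    rintro _ _ ⟨n, m, p, q, S, hp, hq, rfl⟩ ⟨n', m', p', q', S', hp', hq', rfl⟩
    -- Common refinement of the two grids.
    refine ⟨n * n', m * m', fun x => finProdFinEquiv (p x, p' x),
      fun y => finProdFinEquiv (q y, q' y),
      {c | ((finProdFinEquiv.symm c.1).1, (finProdFinEquiv.symm c.2).1) ∈ S ∨
        ((finProdFinEquiv.symm c.1).2, (finProdFinEquiv.symm c.2).2) ∈ S'},
      (measurable_of_finite _).comp (hp.prodMk hp'), (measurable_of_finite _).comp (hq.prodMk hq'),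
      ?_⟩
    ext ⟨x, y⟩
    simp only [Set.mem_union, Set.mem_preimage, Prod.map_apply, Set.mem_ofPred_eq,
      Equiv.symm_apply_apply]

theorem generateFrom_gridSets :
    (inferInstance : MeasurableSpace (α × β)) = MeasurableSpace.generateFrom (gridSets α β) := by
  refine le_antisymm ?_ (MeasurableSpace.generateFrom_le ?_)
  · rw [← generateFrom_prod]
    refine MeasurableSpace.generateFrom_le ?_
    rintro _ ⟨s, hs, t, ht, rfl⟩
    classical
    refine MeasurableSpace.measurableSet_generateFrom
      ⟨2, 2, fun x => if x ∈ s then 1 else 0, fun y => if y ∈ t then 1 else 0, {(1, 1)},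
        Measurable.ite hs measurable_const measurable_const,
        Measurable.ite ht measurable_const measurable_const, ?_⟩
    ext ⟨x, y⟩
    by_cases hx : x ∈ s <;> by_cases hy : y ∈ t <;> simp [hx, hy]
  · rintro _ ⟨n, m, p, q, S, hp, hq, rfl⟩
    exact (hp.prodMap hq) S.toFinite.measurableSet

/-- Grid sets form an algebra generating the product σ-algebra, hence are dense for `μ + ν`: one
grid set approximates `E` for both measures at once. -/
theorem measureReal_le_of_gridSets {μ ν : Measure (α × β)} [IsFiniteMeasure μ] [IsFiniteMeasure ν]
    {c : ℝ} (h : ∀ E ∈ gridSets α β, μ.real E ≤ ν.real E + c) {E : Set (α × β)}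
    (hE : MeasurableSet E) : μ.real E ≤ ν.real E + c := by
  refine le_of_forall_pos_le_add fun ε hε => ?_
  have hdense := Measure.MeasureDense.of_generateFrom_isSetAlgebra_finite (μ := μ + ν)
    isSetAlgebra_gridSets generateFrom_gridSets
  obtain ⟨t, ht, hlt⟩ := hdense.approx E hE (measure_ne_top _ _) ε hε
  have hsum : μ.real (symmDiff E t) + ν.real (symmDiff E t) < ε := by
    rw [← measureReal_add_apply, Measure.real]
    exact ENNReal.toReal_lt_of_lt_ofReal hlt
  have h1 : μ.real E ≤ μ.real t + μ.real (symmDiff E t) :=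
    (measureReal_mono (fun x hx => by
      by_cases hxt : x ∈ t
      · exact Or.inl hxt
      · exact Or.inr (Or.inl ⟨hx, hxt⟩))).trans (measureReal_union_le _ _)
  have h2 : ν.real t ≤ ν.real E + ν.real (symmDiff E t) :=
    (measureReal_mono (fun x hx => by
      by_cases hxE : x ∈ E
      · exact Or.inl hxE
      · exact Or.inr (Or.inr ⟨hx, hxE⟩))).trans (measureReal_union_le _ _)
  linarith [h t ht]

/-- By Hahn decomposition, the excess of `μ` over `ν` lives on a set `s`, and since `F ≤ 1` its
integral is at most `μ s - ν s`. Complementary integrals of `1 - F` replace subtraction. -/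
theorem lintegral_le_of_measure_le {μ ν : Measure α} [IsFiniteMeasure μ] [IsFiniteMeasure ν]
    {ε : ℝ≥0∞} (h : ∀ E, MeasurableSet E → μ E ≤ ν E + ε) {F : α → ℝ≥0∞} (hF : Measurable F)
    (hF1 : ∀ x, F x ≤ 1) : ∫⁻ x, F x ∂μ ≤ ∫⁻ x, F x ∂ν + ε := by
  obtain ⟨s, hs, hpos, hneg⟩ := hahn_decomposition μ ν
  have hsle : ν.restrict s ≤ μ.restrict s := Measure.le_iff.2 fun t ht => by
    rw [Measure.restrict_apply ht, Measure.restrict_apply ht]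
    exact hpos _ (ht.inter hs) Set.inter_subset_right
  have hcle : μ.restrict sᶜ ≤ ν.restrict sᶜ := Measure.le_iff.2 fun t ht => by
    rw [Measure.restrict_apply ht, Measure.restrict_apply ht]
    exact hneg _ (ht.inter hs.compl) Set.inter_subset_right
  have hsplit : ∀ ρ : Measure α, ∫⁻ x in s, F x ∂ρ + ∫⁻ x in s, (1 - F x) ∂ρ = ρ s := fun ρ => by
    rw [← lintegral_add_left hF]
    simp [add_tsub_cancel_of_le (hF1 _)]
  have hfin : ∫⁻ x in s, (1 - F x) ∂μ ≠ ∞ :=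
    ne_top_of_le_ne_top (measure_ne_top μ s) (hsplit μ ▸ le_add_self)
  have h1 : ∫⁻ x in s, F x ∂μ ≤ ∫⁻ x in s, F x ∂ν + ε := by
    refine (ENNReal.add_le_add_iff_right hfin).1 ?_
    calc _ = μ s := hsplit μ
      _ ≤ ν s + ε := h s hs
      _ = ∫⁻ x in s, F x ∂ν + ∫⁻ x in s, (1 - F x) ∂ν + ε := by rw [hsplit]
      _ ≤ ∫⁻ x in s, F x ∂ν + ∫⁻ x in s, (1 - F x) ∂μ + ε := by gcongr
      _ = _ := by ring
  rw [← lintegral_add_compl F hs, ← lintegral_add_compl (μ := ν) F hs]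
  calc _ ≤ ∫⁻ x in s, F x ∂ν + ε + ∫⁻ x in sᶜ, F x ∂ν := by gcongr
    _ = _ := by ring

end Rectangles

/-! ### β-mixing versus the joint law of two coordinates -/

section Chain

variable {Ω : Type*} [mΩ : MeasurableSpace Ω] {P : Measure Ω} {X : ℤ → Ω → ℝ}
  [IsProbabilityMeasure P] {κ : Kernel ℝ ℝ} [IsMarkovKernel κ]

/-- The mixing coefficient controls the distance of the law of `(X 0, X m)` to the product law. -/
theorem HasTransition.mixingBound (h : HasTransition P X κ) (m : ℕ) :
    MixingBound (P.map (X 0)) (κ ^ m) (ENNReal.ofReal (2 * betaMixing P X m)) := by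
  have hX := h.chain.measurable
  have := isMarkovKernel_pow κ m
  have : IsProbabilityMeasure (P.map (X 0)) := Measure.isProbabilityMeasure_map (hX 0).aemeasurable
  have hpair : Measurable fun ω => (X 0 ω, X m ω) := (hX 0).prodMk (hX m)
  set J := P.map fun ω => (X 0 ω, X m ω) with hJ
  have : IsProbabilityMeasure J := Measure.isProbabilityMeasure_map hpair.aemeasurable
  set π := P.map (X 0) with hπ
  -- The signed deviation over the cells of `E` is bounded by the full absolute sum, hence the
  -- factor `2`; it is harmless in the limit.
  have hgrid : ∀ E ∈ gridSets ℝ ℝ, J.real E ≤ (π.prod π).real E + 2 * betaMixing P X m := by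
    rintro E ⟨n, l, p, q, S, hp, hq, rfl⟩
    classical
    set T : Finset (Fin n × Fin l) := S.toFinite.toFinset
    have hcell : ∀ ρ : Measure (ℝ × ℝ), IsFiniteMeasure ρ → ρ.real (Prod.map p q ⁻¹' S)
        = ∑ c ∈ T, ρ.real ((p ⁻¹' {c.1}) ×ˢ (q ⁻¹' {c.2})) := by
      intro ρ _
      rw [← measureReal_biUnion_finset]
      · congr 1
        ext ⟨x, y⟩
        simp [T]
      · intro c _ c' _ hcc'
        refine Set.disjoint_left.2 fun z h1 h2 => hcc' ?_
        exact Prod.ext (h1.1.symm.trans h2.1) (h1.2.symm.trans h2.2)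
      · exact fun c _ => (hp (measurableSet_singleton _)).prod (hq (measurableSet_singleton _))
    have hsum := sum_abs_le_betaCoeff (P := P) (h.chain.past_le 0) (h.chain.future_le m)
      (isMeasurablePartition_preimage (measurable_past X 0) hp)
      (isMeasurablePartition_preimage (Measurable.of_comap_le (comap_le_future X m)) hq)
    rw [← Fintype.sum_prod_type'
      (f := fun (i : Fin n) (j : Fin l) => |P.real (X 0 ⁻¹' (p ⁻¹' {i}) ∩ X m ⁻¹' (q ⁻¹' {j}))
        - P.real (X 0 ⁻¹' (p ⁻¹' {i})) * P.real (X m ⁻¹' (q ⁻¹' {j}))|)] at hsum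
    rw [hcell J inferInstance, hcell (π.prod π) inferInstance, ← sub_le_iff_le_add',
      ← Finset.sum_sub_distrib]
    refine le_trans ?_ ((Finset.sum_le_univ_sum_of_nonneg (s := T)
      fun c => abs_nonneg _).trans hsum)
    refine Finset.sum_le_sum fun c _ => ?_
    have hpc := hp (measurableSet_singleton c.1)
    have hqc := hq (measurableSet_singleton c.2)
    rw [measureReal_prod_prod, hJ, map_measureReal_apply hpair (hpc.prod hqc)]
    conv_lhs => rw [hπ]
    rw [map_measureReal_apply (hX 0) hpc, ← h.chain.map_eq m, map_measureReal_apply (hX m) hqc]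
    exact le_abs_self _
  have hset : ∀ E, MeasurableSet E →
      J E ≤ (π.prod π) E + ENNReal.ofReal (2 * betaMixing P X m) := by
    intro E hE
    have h1 := measureReal_le_of_gridSets hgrid hE
    have hβ : 0 ≤ betaMixing P X m := betaCoeff_nonneg
    rw [← ofReal_measureReal (μ := J), ← ofReal_measureReal (μ := π.prod π),
      ← ENNReal.ofReal_add measureReal_nonneg (mul_nonneg zero_le_two hβ)]
    exact ENNReal.ofReal_le_ofReal h1
  intro F hF hF1
  have := lintegral_le_of_measure_le hset hF hF1
  rwa [hJ, h.map_pair_pow m, Measure.lintegral_compProd hF, lintegral_prod _ hF.aemeasurable] at this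

/-- The distance of the law of `(X 0, X m)` to the product law controls the mixing coefficient. -/
theorem HasTransition.betaMixing_le (h : HasTransition P X κ) (m : ℕ) {ε : ℝ} (hε : 0 ≤ ε)
    (hmix : MixingBound (P.map (X 0)) (κ ^ m) (ENNReal.ofReal ε)) : betaMixing P X m ≤ ε := by
  have hX := h.chain.measurable
  have := isMarkovKernel_pow κ m
  have hpm := h.chain.past_le 0
  have hfm := h.chain.future_le m
  refine betaCoeff_le hε hpm hfm fun n l A B hA hB S => ?_
  obtain ⟨f, hf, hf1⟩ := exists_isCondDensity_sum_le_one (P := P) (hX 0) A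
    (fun i => hpm _ (hA.measurable i)) hA.disjoint
  obtain ⟨g, hg, hg1⟩ := exists_isCondDensity_sum_le_one (P := P) (hX m) B
    (fun i => hfm _ (hB.measurable i)) hB.disjoint
  have hfg : ∀ c : Fin n × Fin l, Measurable fun z : ℝ × ℝ => f c.1 z.1 * g c.2 z.2 := fun c =>
    ((hf c.1).1.comp measurable_fst).mul ((hg c.2).1.comp measurable_snd)
  have hfgx : ∀ (c : Fin n × Fin l) (x : ℝ), Measurable fun y : ℝ => f c.1 x * g c.2 y :=
    fun c x => (hg c.2).1.const_mul _
  -- The union of the cells in `S`, seen through `(X 0, X m)`. It is at most `1` because the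
  -- densities are subpartitions of unity.
  have key := hmix (fun z => ∑ c ∈ S, f c.1 z.1 * g c.2 z.2)
    (Finset.measurable_sum _ fun c _ => hfg c) fun z => by
      calc ∑ c ∈ S, f c.1 z.1 * g c.2 z.2 ≤ ∑ c : Fin n × Fin l, f c.1 z.1 * g c.2 z.2 :=
            Finset.sum_le_univ_sum_of_nonneg fun _ => zero_le
        _ = (∑ i, f i z.1) * ∑ j, g j z.2 := by
            rw [Fintype.sum_prod_type, Finset.sum_mul_sum]
        _ ≤ 1 * 1 := mul_le_mul' (hf1 _) (hg1 _)
        _ = 1 := one_mul 1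
  have hL : ∫⁻ x, ∫⁻ y, ∑ c ∈ S, f c.1 x * g c.2 y ∂(κ ^ m) x ∂(P.map (X 0))
      = ∑ c ∈ S, P (A c.1 ∩ B c.2) := by
    simp_rw [lintegral_finsetSum S fun c _ => hfgx c _]
    rw [lintegral_finsetSum S fun c _ => Measurable.lintegral_kernel_prod_right
      (f := fun x y => f c.1 x * g c.2 y) (hfg c)]
    exact Finset.sum_congr rfl fun c _ => (h.measure_past_inter_future m
      (hA.measurable c.1) (hB.measurable c.2) (hf c.1) (hg c.2)).symm
  have hR : ∫⁻ x, ∫⁻ y, ∑ c ∈ S, f c.1 x * g c.2 y ∂(P.map (X 0)) ∂(P.map (X 0))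
      = ∑ c ∈ S, P (A c.1) * P (B c.2) := by
    simp_rw [lintegral_finsetSum S fun c _ => hfgx c _,
      lintegral_const_mul _ (hg _).1]
    rw [lintegral_finsetSum S fun c _ => (hf c.1).1.mul_const _]
    refine Finset.sum_congr rfl fun c _ => ?_
    rw [lintegral_mul_const _ (hf c.1).1, (hf c.1).lintegral]
    conv_lhs => rw [← h.chain.map_eq m]
    rw [(hg c.2).lintegral]
  simp only at key
  rw [hL, hR] at key
  have h3 := ENNReal.toReal_mono (ENNReal.add_ne_top.2 ⟨ENNReal.sum_ne_top.2 fun c _ =>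
    ENNReal.mul_ne_top (measure_ne_top _ _) (measure_ne_top _ _), ENNReal.ofReal_ne_top⟩) key
  rw [ENNReal.toReal_add (ENNReal.sum_ne_top.2 fun c _ =>
    ENNReal.mul_ne_top (measure_ne_top _ _) (measure_ne_top _ _)) ENNReal.ofReal_ne_top,
    ENNReal.toReal_sum fun c _ => measure_ne_top _ _,
    ENNReal.toReal_sum fun c _ => ENNReal.mul_ne_top (measure_ne_top _ _) (measure_ne_top _ _),
    ENNReal.toReal_ofReal hε] at h3
  simpa only [ENNReal.toReal_mul, Measure.real] using h3

end Chain

/-! ### Convex combinations of kernels -/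

section Mixture

variable {α β ι : Type*} [MeasurableSpace α] [MeasurableSpace β] [Fintype ι]

/-- The combination of the kernels `κ i` with weights `a i`. -/
noncomputable def mixKernel (a : ι → ℝ≥0∞) (κ : ι → Kernel α β) : Kernel α β where
  toFun x := ∑ i, a i • κ i x
  measurable' := by
    refine Measure.measurable_of_measurable_coe _ fun s hs => ?_
    simp only [Measure.coe_finsetSum, Finset.sum_apply, Measure.smul_apply, smul_eq_mul]
    exact Finset.measurable_sum _ fun i _ => ((κ i).measurable_coe hs).const_mul _

theorem mixKernel_apply (a : ι → ℝ≥0∞) (κ : ι → Kernel α β) (x : α) (s : Set β) :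
    mixKernel a κ x s = ∑ i, a i * κ i x s := by
  change (∑ i, a i • κ i x) s = _
  simp

theorem isMarkovKernel_mixKernel {a : ι → ℝ≥0∞} (ha : ∑ i, a i = 1) (κ : ι → Kernel α β)
    [∀ i, IsMarkovKernel (κ i)] : IsMarkovKernel (mixKernel a κ) :=
  ⟨fun x => ⟨by rw [mixKernel_apply]; simpa using ha⟩⟩

theorem smul_le_mixKernel (a : ι → ℝ≥0∞) (κ : ι → Kernel α β) (j : ι) (x : α) :
    a j • κ j x ≤ mixKernel a κ x := by
  refine Measure.le_iff.2 fun s _ => ?_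
  rw [mixKernel_apply]
  exact Finset.single_le_sum (f := fun i => a i * κ i x s) (fun _ _ => zero_le)
    (Finset.mem_univ j)

theorem compProd_mixKernel_apply {a : ι → ℝ≥0∞} (ha : ∑ i, a i = 1) (κ : ι → Kernel α β)
    [∀ i, IsMarkovKernel (κ i)] (π : Measure α) [SFinite π] {s : Set (α × β)}
    (hs : MeasurableSet s) : (π ⊗ₘ mixKernel a κ) s = ∑ i, a i * (π ⊗ₘ κ i) s := by
  have := isMarkovKernel_mixKernel ha κ
  rw [Measure.compProd_apply hs]
  simp_rw [mixKernel_apply, Measure.compProd_apply hs]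
  rw [lintegral_finsetSum _ fun i _ => (Kernel.measurable_kernel_prodMk_left hs).const_mul _]
  exact Finset.sum_congr rfl fun i _ =>
    lintegral_const_mul _ (Kernel.measurable_kernel_prodMk_left hs)

end Mixture

/-! ### Copulas and transition kernels -/

section Copula

instance : IsProbabilityMeasure uniformLaw := ⟨by simp [uniformLaw]⟩

theorem ae_mem_Ioc_uniformLaw : ∀ᵐ u ∂uniformLaw, u ∈ Set.Ioc (0 : ℝ) 1 := by
  rw [uniformLaw, ← Measure.restrict_congr_set Ioc_ae_eq_Icc]
  exact ae_restrict_mem measurableSet_Ioc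

theorem cdf_uniformLaw (x : ℝ) : cdf uniformLaw x = max 0 (min x 1) := by
  rw [cdf_eq_real, uniformLaw, measureReal_restrict_apply measurableSet_Iic]
  have : Set.Iic x ∩ Set.Icc 0 1 = Set.Icc 0 (min x 1) := by
    ext u
    simp only [Set.mem_inter_iff, Set.mem_Iic, Set.mem_Icc, le_min_iff]
    tauto
  rw [this, Real.volume_real_Icc, sub_zero, max_comm]

/-- The point `u = 0` must be excluded: for `x < 0` the distribution function is `0`, while `0 ≤ x`
fails. -/
theorem le_cdf_uniformLaw_iff {u : ℝ} (hu : u ∈ Set.Ioc (0 : ℝ) 1) (x : ℝ) :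
    u ≤ cdf uniformLaw x ↔ u ≤ x := by
  rw [cdf_uniformLaw, le_max_iff, le_min_iff]
  exact ⟨fun h => h.elim (fun h => absurd h (not_le.2 hu.1)) And.left, fun h => Or.inr ⟨h, hu.2⟩⟩

variable {Ω : Type*} [MeasurableSpace Ω] {P : Measure Ω} [IsProbabilityMeasure P] {X : ℤ → Ω → ℝ}
  {C : ℝ → ℝ → ℝ}

/-- Quadrants determine a law on the plane, and clamping their corners to `[0,1]` changes them only
by a `μ`-null set. -/
theorem IsGeneratedByCopula.map_pair (h : IsGeneratedByCopula P X C) {μ : Measure (ℝ × ℝ)}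
    [IsProbabilityMeasure μ] (hfst : μ.map Prod.fst = uniformLaw)
    (hsnd : μ.map Prod.snd = uniformLaw)
    (hC : ∀ x y, C x y = μ.real (Set.Iic x ×ˢ Set.Iic y)) :
    P.map (fun ω => (X 0 ω, X 1 ω)) = μ := by
  have hX := h.chain.measurable
  have hpair : Measurable fun ω => (X 0 ω, X 1 ω) := (hX 0).prodMk (hX 1)
  have : IsProbabilityMeasure (P.map fun ω => (X 0 ω, X 1 ω)) :=
    Measure.isProbabilityMeasure_map hpair.aemeasurable
  have hspan : IsCountablySpanning (Set.range (Set.Iic : ℝ → Set ℝ)) :=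
    ⟨fun n : ℕ => Set.Iic (n : ℝ), fun n => ⟨n, rfl⟩,
      Set.eq_univ_of_forall fun x => Set.mem_iUnion.2 (exists_nat_ge x)⟩
  refine ext_of_generate_finite _
    (generateFrom_eq_prod (borel_eq_generateFrom_Iic ℝ ▸ (BorelSpace.measurable_eq (α := ℝ)).symm)
      (borel_eq_generateFrom_Iic ℝ ▸ (BorelSpace.measurable_eq (α := ℝ)).symm) hspan hspan).symm
    (isPiSystem_Iic.prod isPiSystem_Iic) ?_ (by simp)
  rintro _ ⟨_, ⟨x, rfl⟩, _, ⟨y, rfl⟩, rfl⟩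
  have hae : (Set.Iic (cdf uniformLaw x) ×ˢ Set.Iic (cdf uniformLaw y) : Set (ℝ × ℝ)) =ᵐ[μ]
      (Set.Iic x ×ˢ Set.Iic y : Set (ℝ × ℝ)) := by
    have h1 := ae_of_ae_map measurable_fst.aemeasurable (hfst ▸ ae_mem_Ioc_uniformLaw)
    have h2 := ae_of_ae_map measurable_snd.aemeasurable (hsnd ▸ ae_mem_Ioc_uniformLaw)
    filter_upwards [h1, h2] with z hz1 hz2
    exact propext (and_congr (le_cdf_uniformLaw_iff hz1 x) (le_cdf_uniformLaw_iff hz2 y))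
  have hj := h.joint x y
  rw [hC, measureReal_congr hae] at hj
  rw [← measureReal_eq_measureReal_iff,
    map_measureReal_apply hpair (measurableSet_Iic.prod measurableSet_Iic), ← hj]
  rfl

theorem IsGeneratedByCopula.hasTransition (h : IsGeneratedByCopula P X C) {κ : Kernel ℝ ℝ}
    [IsMarkovKernel κ] (hκ : κ.Invariant uniformLaw)
    (hC : ∀ x y, C x y = (uniformLaw ⊗ₘ κ).real (Set.Iic x ×ˢ Set.Iic y)) :
    HasTransition P X κ where
  chain := h.chain
  law := by
    rw [h.marginal]
    exact h.map_pair (Measure.fst_compProd _ _) ((Measure.snd_compProd _ _).trans hκ) hC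

theorem IsCopula.exists_kernel (hC : IsCopula C) : ∃ κ : Kernel ℝ ℝ, IsMarkovKernel κ ∧
    κ.Invariant uniformLaw ∧
    ∀ x y, C x y = (uniformLaw ⊗ₘ κ).real (Set.Iic x ×ˢ Set.Iic y) := by
  obtain ⟨μ, _, hfst, hsnd, hμ⟩ := hC
  have hd : uniformLaw ⊗ₘ μ.condKernel = μ := by
    rw [← hfst]
    exact μ.disintegrate μ.condKernel
  refine ⟨μ.condKernel, inferInstance, ?_, fun x y => by rw [hd, hμ]⟩
  rw [Kernel.Invariant, ← Measure.snd_compProd, hd]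
  exact hsnd

end Copula

end CopulaChain

/-! ### The lemma on convex combinations -/

open CopulaChain in
theorem lemma3p1 {n : ℕ} (C : Fin n → ℝ → ℝ → ℝ) (hC : ∀ k, CopulaChain.IsCopula (C k))
    (j : Fin n)
    -- the copula `C j` generates an absolutely regular Markov chain
    {Ω₀ : Type*} [MeasurableSpace Ω₀] (P₀ : Measure Ω₀) [IsProbabilityMeasure P₀]
    (V : ℤ → Ω₀ → ℝ) (hV : CopulaChain.IsGeneratedByCopula P₀ V (C j))
    (hreg : CopulaChain.IsAbsolutelyRegular P₀ V)
    (a : Fin n → ℝ) (ha : ∀ k, 0 ≤ a k ∧ a k ≤ 1) (hsum : ∑ k, a k = 1) (haj : a j ≠ 0)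
    -- any stationary Markov chain generated by the convex combination
    {Ω : Type*} [MeasurableSpace Ω] (P : Measure Ω) [IsProbabilityMeasure P]
    (U : ℤ → Ω → ℝ)
    (hU : CopulaChain.IsGeneratedByCopula P U (fun x y => ∑ k, a k * C k x y)) :
    CopulaChain.IsAbsolutelyRegular P U := by
  choose κ hκM hκI hκC using fun k => (hC k).exists_kernel
  set b : Fin n → ENNReal := fun k => ENNReal.ofReal (a k)
  have hb : ∑ k, b k = 1 := by
    rw [← ENNReal.ofReal_sum_of_nonneg fun k _ => (ha k).1, hsum, ENNReal.ofReal_one]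
  have hRM := isMarkovKernel_mixKernel hb κ
  have hRI : (mixKernel b κ).Invariant uniformLaw := by
    rw [Kernel.Invariant, ← Measure.snd_compProd]
    ext s hs
    rw [Measure.snd_apply hs, compProd_mixKernel_apply hb κ _ (measurable_snd hs)]
    have : ∀ k, (uniformLaw ⊗ₘ κ k) (Prod.snd ⁻¹' s) = uniformLaw s := fun k => by
      rw [← Measure.snd_apply hs, Measure.snd_compProd, (hκI k).def]
    simp_rw [this, ← Finset.sum_mul, hb, one_mul]
  have hVt : HasTransition P₀ V (κ j) := hV.hasTransition (hκI j) (hκC j)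
  have hUt : HasTransition P U (mixKernel b κ) := hU.hasTransition hRI fun x y => by
    rw [Measure.real, compProd_mixKernel_apply hb κ _ (measurableSet_Iic.prod measurableSet_Iic),
      ENNReal.toReal_sum fun k _ => ENNReal.mul_ne_top ENNReal.ofReal_ne_top (measure_ne_top _ _)]
    refine Finset.sum_congr rfl fun k _ => ?_
    rw [ENNReal.toReal_mul, ENNReal.toReal_ofReal (ha k).1, hκC k, Measure.real]
  have hmix : ∀ ε : ENNReal, 0 < ε → ∃ m : ℕ, MixingBound uniformLaw (κ j ^ m) ε := by
    intro ε hε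
    have hlim : Tendsto (fun m => ENNReal.ofReal (2 * betaMixing P₀ V m)) atTop (𝓝 0) := by
      have := ENNReal.tendsto_ofReal (Tendsto.const_mul 2 hreg)
      simpa using this
    obtain ⟨m, hm⟩ := (hlim.eventually (ge_mem_nhds hε)).exists
    have hbound := hVt.mixingBound m
    rw [hV.marginal] at hbound
    exact ⟨m, hbound.mono hm⟩
  have hbj : b j ≠ 0 := (ENNReal.ofReal_pos.2 (lt_of_le_of_ne (ha j).1 haj.symm)).ne'
  refine Metric.tendsto_atTop.2 fun ε hε => ?_
  obtain ⟨N, hN⟩ := exists_mixingBound_pow (hκI j) hRI hbj (ENNReal.ofReal_le_one.2 (ha j).2)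
    -- Half of `ε`, since the limit asks for a strict inequality.
    (smul_le_mixKernel b κ j) hmix (ENNReal.ofReal_pos.2 (half_pos hε))
  refine ⟨N, fun m hm => ?_⟩
  have hle := hUt.betaMixing_le m (half_pos hε).le (by rw [hU.marginal]; exact hN m hm)
  have h0 : 0 ≤ betaMixing P U m := betaCoeff_nonneg
  rw [Real.dist_0_eq_abs, abs_of_nonneg h0]
  exact hle.trans_lt (half_lt_self hε)
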